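/- Let $H^1(\mathbb R)=W^{1,2}(\mathbb R)$ be the real Sobolev space, its elements being identified with their continuous representatives. For a bounded measurable $V:\mathbb R\to\mathbb R$ with $\inf V>0$ and $u\in H^1(\mathbb R)$ put $$\|u\|_V^2=\int_{\mathbb R}\bigl(|u'|^2+V|u|^2\bigr)\,dx,\qquad R(u;V)=\frac{\|u\|_V^2}{\|u\|_{L^\infty(\mathbb R)}^2}\ \ (u\not\equiv0),$$ $$m(V)=\inf_{u\in H^1(\mathbb R),\,u\not\equiv0}R(u;V),\qquad M(V)=\{u\in H^1(\mathbb R):\ u\not\equiv0,\ R(u;V)=m(V)\},$$ and for $a\in\mathbb R$ let $K_a=\{u\in H^1(\mathbb R):\ u(a)=\|u\|_{L^\infty(\mathbb R)}=1\}$. Let $A,B>0$ with $AB>\frac{1+\sqrt5}{2}$, and let $$\varphi_+(x)=\frac{Ae^{-Bx}}{\sqrt{x^2+A^2}},\qquad \varphi_-(x)=\frac{A(2B^2x^2-2Bx+2A^2B^2+1)e^{Bx}}{(2A^2B^2+1)\sqrt{x^2+A^2}},\qquad V=(\log\varphi_+)''+\bigl((\log\varphi_+)'\bigr)^2 .$$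 Then, for all $x\in\mathbb R$, $$V(x)=\frac{(B(x^2+A^2)+x)^2+x^2-A^2}{(x^2+A^2)^2}\ \ge\ \frac{A^2B^2-AB-1}{A^2}>0,$$ $V$ is bounded above, and $$m(V)=2B\Bigl(1-\frac{1}{\sqrt{1+4A^2B^2}}\Bigr).$$ Moreover, with $a_1=\dfrac{1-\sqrt{1+4A^2B^2}}{2B}$, the functional $\|\cdot\|_V^2$ has exactly one minimizer $u_{a_1}$ on $K_{a_1}$, namely $$u_{a_1}(x)=\frac{\varphi_-(x)}{\varphi_-(a_1)}\ \ (x<a_1),\qquad u_{a_1}(x)=\frac{\varphi_+(x)}{\varphi_+(a_1)}\ \ (x\ge a_1),$$ and $M(V)=\{c\,u_{a_1}:\ c\in\mathbb R\setminus\{0\}\}$. -/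

import Mathlib

open MeasureTheory

namespace SobolevBest

noncomputable section

/-- `g` is the weak (distributional) derivative of `u` on `ℝ`. -/
def IsWeakDeriv (u g : ℝ → ℝ) : Prop :=
  LocallyIntegrable u volume ∧ LocallyIntegrable g volume ∧
    ∀ φ : ℝ → ℝ, ContDiff ℝ ((⊤ : ℕ∞) : WithTop ℕ∞) φ → HasCompactSupport φ →
      ∫ x, u x * deriv φ x = -∫ x, g x * φ x

/-- `H¹(ℝ) = W^{1,2}(ℝ)`, real valued; every class is represented by its (unique) continuous
representative. -/
def H1 : Set (ℝ → ℝ) :=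
  {u | Continuous u ∧ MemLp u 2 volume ∧ ∃ g, IsWeakDeriv u g ∧ MemLp g 2 volume}

open Classical in
/-- A weak derivative of `u` (unique up to null sets), and `0` if there is none. -/
def weakDeriv (u : ℝ → ℝ) : ℝ → ℝ :=
  if h : ∃ g, IsWeakDeriv u g then Classical.choose h else 0

/-- `I(u; V) = ‖u‖_V² = ∫ (|u'|² + V |u|²) dx`, with `u'` the weak derivative. -/
def energy (V u : ℝ → ℝ) : ℝ := ∫ x, ((weakDeriv u x) ^ 2 + V x * (u x) ^ 2)

/-- The `L^∞(ℝ)` norm. -/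
def supNorm (u : ℝ → ℝ) : ℝ := (eLpNorm u ⊤ volume).toReal

/-- The Rayleigh-type quotient `R(u; V) = ‖u‖_V² / ‖u‖_∞²`. -/
def rayleigh (V u : ℝ → ℝ) : ℝ := energy V u / supNorm u ^ 2

/-- `m(V)`, the infimum of `R(u; V)` over `u ∈ H¹(ℝ)`, `u ≢ 0`. -/
def bestQuantity (V : ℝ → ℝ) : ℝ := sInf (rayleigh V '' {u | u ∈ H1 ∧ u ≠ 0})

/-- `M(V)`, the set of minimizers of `R(u; V)` over `u ∈ H¹(ℝ)`, `u ≢ 0`. -/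
def minimizers (V : ℝ → ℝ) : Set (ℝ → ℝ) :=
  {u | u ∈ H1 ∧ u ≠ 0 ∧ bestQuantity V = rayleigh V u}

/-- `K_a = {u ∈ H¹(ℝ) ; u(a) = ‖u‖_∞ = 1}`. -/
def peakSet (a : ℝ) : Set (ℝ → ℝ) := {u | u ∈ H1 ∧ u a = 1 ∧ supNorm u = 1}

/-- `u` minimizes `‖·‖_V²` over `K_a`. -/
def IsPeakMinimizer (V : ℝ → ℝ) (a : ℝ) (u : ℝ → ℝ) : Prop :=
  u ∈ peakSet a ∧ ∀ w ∈ peakSet a, energy V u ≤ energy V w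

/-- `φ₊(x) = A e^{-Bx} / √(x² + A²)`. -/
def phiPlus (A B x : ℝ) : ℝ := A * Real.exp (-(B * x)) / Real.sqrt (x ^ 2 + A ^ 2)

/-- `φ₋(x) = A (2B²x² - 2Bx + 2A²B² + 1) e^{Bx} / ((2A²B² + 1) √(x² + A²))`. -/
def phiMinus (A B x : ℝ) : ℝ :=
  A * (2 * B ^ 2 * x ^ 2 - 2 * B * x + 2 * A ^ 2 * B ^ 2 + 1) * Real.exp (B * x) /
    ((2 * A ^ 2 * B ^ 2 + 1) * Real.sqrt (x ^ 2 + A ^ 2))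

/-- `ℓ₊ = log φ₊`. -/
def ellPlus (A B x : ℝ) : ℝ := Real.log (phiPlus A B x)

/-- The potential `V = ℓ₊'' + (ℓ₊')²`. -/
def potential (A B x : ℝ) : ℝ :=
  deriv (deriv (ellPlus A B)) x + (deriv (ellPlus A B) x) ^ 2

/-- `a₁ = (1 - √(1 + 4A²B²)) / (2B)`. -/
def peakPoint (A B : ℝ) : ℝ := (1 - Real.sqrt (1 + 4 * A ^ 2 * B ^ 2)) / (2 * B)

end

end SobolevBest

/-! The proof completes the square with solutions of a Riccati equation. The logarithmic derivatives
`r` of `phiPlus` and `s` of `phiMinus` both solve r' + r² = V, so u'² + V u² − (u' − r u)² = (r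
u²)', and likewise with `s`. Using `s` to the left of a point p and `r` to the right gives, since u²
vanishes at infinity, ‖u‖_V² = ∫ (u' − q u)² + (s(p) − r(p)) u(p)², where q is `glue p s r`
(`energy_eq_residual_add`). Taking p where |u| is maximal bounds the quotient below by the gap s(p)
− r(p), hence by the minimum of the gap.

Here the gap is 4B³(x² + A²)/`quadMinus A B x`, with strict minimum at `peakPoint A B`
(`gap_lt_of_ne`). Equality forces u to peak there and the square to vanish, that is u' = q u; the
solutions are the multiples of the two branches glued at the peak. The same inequality at a general
point shows that the glued function is bounded by 1, hence admissible. -/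

namespace SobolevBest

open Set Filter Topology
open scoped ContDiff Convolution

/-! ### Primitives, weak derivatives and the du Bois-Reymond lemma -/

/-- `u` is a primitive of the locally integrable function `g`. -/
structure IsPrimitive (u g : ℝ → ℝ) : Prop where
  locallyIntegrable : LocallyIntegrable g volume
  integral_eq : ∀ x y, ∫ t in x..y, g t = u y - u x

namespace IsPrimitive

variable {u v g h : ℝ → ℝ}

theorem intervalIntegrable (hu : IsPrimitive u g) (a b : ℝ) : IntervalIntegrable g volume a b :=
  intervalIntegrable_iff.mpr <|
    (hu.locallyIntegrable.integrableOn_isCompact isCompact_uIcc).mono_set uIoc_subset_uIcc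

theorem eq_add (hu : IsPrimitive u g) (a : ℝ) : u = fun x => u a + ∫ t in a..x, g t := by
  funext x
  rw [hu.integral_eq]
  ring

theorem continuous (hu : IsPrimitive u g) : Continuous u := by
  rw [hu.eq_add 0]
  exact continuous_const.add
    (intervalIntegral.continuous_primitive (fun a b => hu.intervalIntegrable a b) 0)

theorem absolutelyContinuousOnInterval (hu : IsPrimitive u g) (a b : ℝ) :
    AbsolutelyContinuousOnInterval u a b := by
  rw [hu.eq_add a]
  have h1 := (hu.intervalIntegrable a b).absolutelyContinuousOnInterval_intervalIntegral
    (c := a) left_mem_uIcc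
  have h2 : AbsolutelyContinuousOnInterval (fun _ : ℝ => u a) a b :=
    ((LipschitzWith.const (u a)).lipschitzOnWith).absolutelyContinuousOnInterval
  exact h2.add h1

theorem ae_hasDerivAt (hu : IsPrimitive u g) : ∀ᵐ x, HasDerivAt u (g x) x := by
  filter_upwards [_root_.LocallyIntegrable.ae_hasDerivAt_integral hu.locallyIntegrable] with x hx
  rw [hu.eq_add 0]
  exact (hx 0).const_add _

theorem mul (hu : IsPrimitive u g) (hv : IsPrimitive v h) :
    IsPrimitive (fun x => u x * v x) (fun x => g x * v x + u x * h x) where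
  locallyIntegrable := by
    refine LocallyIntegrable.add ?_ ?_
    · have := hu.locallyIntegrable.smul_continuous hv.continuous
      simpa [smul_eq_mul, mul_comm] using this
    · have := hv.locallyIntegrable.continuous_smul hu.continuous
      simpa [smul_eq_mul] using this
  integral_eq x y := by
    rw [← AbsolutelyContinuousOnInterval.integral_deriv_mul_eq_sub
      (hu.absolutelyContinuousOnInterval x y) (hv.absolutelyContinuousOnInterval x y)]
    apply intervalIntegral.integral_congr_ae
    filter_upwards [hu.ae_hasDerivAt, hv.ae_hasDerivAt] with t h1 h2 _
    rw [h1.deriv, h2.deriv]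

theorem congr_ae (hu : IsPrimitive u g) (hgh : g =ᵐ[volume] h) : IsPrimitive u h where
  locallyIntegrable := hu.locallyIntegrable.congr hgh
  integral_eq x y := by
    rw [← hu.integral_eq]
    apply intervalIntegral.integral_congr_ae
    filter_upwards [hgh] with t ht _ using ht.symm

theorem const_mul (hu : IsPrimitive u g) (c : ℝ) :
    IsPrimitive (fun x => c * u x) (fun x => c * g x) where
  locallyIntegrable := hu.locallyIntegrable.smul c
  integral_eq x y := by
    rw [intervalIntegral.integral_const_mul, hu.integral_eq]
    ring

theorem of_hasDerivAt (hu : ∀ x, HasDerivAt u (g x) x) (hg : Continuous g) :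
    IsPrimitive u g where
  locallyIntegrable := hg.locallyIntegrable
  integral_eq x y := intervalIntegral.integral_eq_sub_of_hasDerivAt (fun t _ => hu t)
    (hg.intervalIntegrable x y)

theorem isWeakDeriv (hu : IsPrimitive u g) : IsWeakDeriv u g := by
  refine ⟨hu.continuous.locallyIntegrable, hu.locallyIntegrable, fun φ hφ hc => ?_⟩
  have hφd : ∀ x, HasDerivAt φ (deriv φ x) x := fun x =>
    ((hφ.differentiable (by simp)) x).hasDerivAt
  have hφc : Continuous (deriv φ) := hφ.continuous_deriv (by simp)
  have hp := hu.mul (of_hasDerivAt hφd hφc)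
  obtain ⟨R, hR⟩ := hc.isCompact.isBounded.subset_closedBall 0
  rw [Real.closedBall_eq_Icc] at hR
  have i1 : Integrable (fun x => u x * deriv φ x) := by
    simpa [smul_eq_mul] using
      hu.continuous.locallyIntegrable.integrable_smul_right_of_hasCompactSupport hφc hc.deriv
  have i2 : Integrable (fun x => g x * φ x) := by
    simpa [smul_eq_mul] using
      hu.locallyIntegrable.integrable_smul_right_of_hasCompactSupport hφ.continuous hc
  have hz : ∀ x, x ∉ Icc (0 - R) (0 + R) → φ x = 0 ∧ deriv φ x = 0 := fun x hx =>
    ⟨image_eq_zero_of_notMem_tsupport fun h => hx (hR h),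
      image_eq_zero_of_notMem_tsupport fun h => hx (hR (tsupport_deriv_subset h))⟩
  have key : ∫ x, (g x * φ x + u x * deriv φ x) = 0 := by
    -- The interval extends beyond the support of φ, so the boundary terms vanish; |R| is used
    -- because R may be negative when the support is empty.
    have hs : Function.support (fun x => g x * φ x + u x * deriv φ x) ⊆
        Ioc (-|R| - 1) (|R| + 1) := by
      intro x hx
      by_contra hn
      apply hx
      obtain ⟨h1, h2⟩ := hz x (fun hm => hn ⟨by linarith [hm.1, le_abs_self R],
        by linarith [hm.2, le_abs_self R]⟩)
      simp [h1, h2]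
    rw [← intervalIntegral.integral_eq_integral_of_support_subset hs, hp.integral_eq,
      (hz (|R| + 1) (fun hm => by linarith [hm.2, le_abs_self R])).1,
      (hz (-|R| - 1) (fun hm => by linarith [hm.1, le_abs_self R])).1]
    ring
  rw [integral_add i2 i1] at key
  linarith

end IsPrimitive

/-- Mollification: the derivative of ψ ⋆ f is ψ' ⋆ f, which vanishes by testing against a reflected
translate of ψ. So every mollification is constant, and they converge pointwise to the continuous f.
-/
theorem eq_of_integral_mul_deriv_eq_zero {f : ℝ → ℝ} (hf : Continuous f)
    (h : ∀ φ : ℝ → ℝ, ContDiff ℝ ∞ φ → HasCompactSupport φ → ∫ x, f x * deriv φ x = 0)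
    (x y : ℝ) : f x = f y := by
  let b : ℕ → ContDiffBump (0 : ℝ) := fun n =>
    ⟨1 / ((n : ℝ) + 1), 2 / ((n : ℝ) + 1), by positivity, by gcongr; norm_num⟩
  have hb : Tendsto (fun n => (b n).rOut) atTop (𝓝 0) := by
    simpa [b, div_eq_mul_inv] using (tendsto_one_div_add_atTop_nhds_zero_nat (𝕜 := ℝ)).const_mul 2
  have lim : ∀ z, Tendsto (fun n => ((b n).normed volume ⋆[ContinuousLinearMap.lsmul ℝ ℝ, volume] f) z)
      atTop (𝓝 (f z)) := fun z =>
    ContDiffBump.convolution_tendsto_right_of_continuous hb hf z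
  have hconst : ∀ n, ((b n).normed volume ⋆[ContinuousLinearMap.lsmul ℝ ℝ, volume] f) x =
      ((b n).normed volume ⋆[ContinuousLinearMap.lsmul ℝ ℝ, volume] f) y := by
    intro n
    set ψ := (b n).normed volume
    have hψ : ContDiff ℝ ∞ ψ := (b n).contDiff_normed
    have hψc : HasCompactSupport ψ := (b n).hasCompactSupport_normed
    have hd : ∀ z, HasDerivAt (ψ ⋆[ContinuousLinearMap.lsmul ℝ ℝ, volume] f) 0 z := by
      intro z
      have h1 := hψc.hasDerivAt_convolution_left (ContinuousLinearMap.lsmul ℝ ℝ)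
        (hψ.of_le (by simp)) hf.locallyIntegrable z (μ := volume)
      have h2 : (deriv ψ ⋆[ContinuousLinearMap.lsmul ℝ ℝ, volume] f) z = 0 := by
        rw [convolution_eq_swap]
        have h3 := h (fun t => ψ (z - t)) (hψ.comp (contDiff_const.sub contDiff_id))
          (hψc.comp_homeomorph (Homeomorph.subLeft z))
        have h4 : ∀ t, deriv (fun t => ψ (z - t)) t = - deriv ψ (z - t) := fun t =>
          deriv_comp_const_sub ψ z t
        simp only [h4, mul_neg, integral_neg, neg_eq_zero] at h3
        simpa [mul_comm] using h3
      rwa [h2] at h1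
    exact is_const_of_deriv_eq_zero (fun z => (hd z).differentiableAt) (fun z => (hd z).deriv) x y
  exact tendsto_nhds_unique (lim x) ((lim y).congr fun n => (hconst n).symm)

namespace IsWeakDeriv

variable {u g h : ℝ → ℝ}

theorem ae_eq (hg : IsWeakDeriv u g) (hh : IsWeakDeriv u h) : g =ᵐ[volume] h := by
  have := ae_eq_zero_of_integral_contDiff_smul_eq_zero (hg.2.1.sub hh.2.1) fun φ hφ hc => by
    have i1 : Integrable (fun x => g x * φ x) := by
      simpa [smul_eq_mul] using
        hg.2.1.integrable_smul_right_of_hasCompactSupport hφ.continuous hc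
    have i2 : Integrable (fun x => h x * φ x) := by
      simpa [smul_eq_mul] using
        hh.2.1.integrable_smul_right_of_hasCompactSupport hφ.continuous hc
    have e := integral_sub i1 i2
    rw [show (∫ x, g x * φ x) = ∫ x, h x * φ x by linarith [hg.2.2 φ hφ hc, hh.2.2 φ hφ hc],
      sub_self] at e
    rw [← e]
    congr 1
    funext x
    simp only [smul_eq_mul, Pi.sub_apply]
    ring
  filter_upwards [this] with x hx
  simpa [sub_eq_zero] using hx

/-- The difference of `u` and a primitive of `g` has zero weak derivative and is continuous, hence
constant. -/
theorem isPrimitive (hg : IsWeakDeriv u g) (hu : Continuous u) : IsPrimitive u g := by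
  have hii : ∀ a b, IntervalIntegrable g volume a b := fun a b =>
    intervalIntegrable_iff.mpr <|
      (hg.2.1.integrableOn_isCompact isCompact_uIcc).mono_set uIoc_subset_uIcc
  have hF : IsPrimitive (fun x => ∫ t in (0 : ℝ)..x, g t) g :=
    ⟨hg.2.1, fun x y => by rw [intervalIntegral.integral_interval_sub_left (hii _ _) (hii _ _)]⟩
  have hc := eq_of_integral_mul_deriv_eq_zero (hu.sub hF.continuous) fun φ hφ hc => by
    have hφc : Continuous (deriv φ) := hφ.continuous_deriv (by simp)
    have i1 : Integrable (fun x => u x * deriv φ x) := by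
      simpa [smul_eq_mul] using
        hu.locallyIntegrable.integrable_smul_right_of_hasCompactSupport hφc hc.deriv
    have i2 : Integrable (fun x => (∫ t in (0 : ℝ)..x, g t) * deriv φ x) := by
      simpa [smul_eq_mul] using
        hF.continuous.locallyIntegrable.integrable_smul_right_of_hasCompactSupport hφc hc.deriv
    simp only [Pi.sub_apply, sub_mul]
    rw [integral_sub i1 i2, hg.2.2 φ hφ hc, hF.isWeakDeriv.2.2 φ hφ hc, sub_self]
  refine ⟨hg.2.1, fun x y => ?_⟩
  have := hc x y
  simp only [Pi.sub_apply] at this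
  rw [hF.integral_eq]
  linarith

end IsWeakDeriv

/-! ### Decay at infinity and properties of H¹ functions -/

namespace IsPrimitive

variable {u g : ℝ → ℝ}

/-- Integrability of `g` makes the limit exist; integrability of `u` forces it to be 0. -/
theorem tendsto_atTop (hu : IsPrimitive u g) (hg : Integrable g) (hi : Integrable u) :
    Tendsto u atTop (𝓝 0) := by
  have h1 : Tendsto u atTop (𝓝 (u 0 + ∫ t in Ioi 0, g t)) := by
    nth_rw 1 [hu.eq_add 0]
    exact (intervalIntegral_tendsto_integral_Ioi 0 hg.integrableOn tendsto_id).const_add _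
  have h2 := IntegrableAtFilter.eq_zero_of_tendsto
    (⟨Ioi 0, Ioi_mem_atTop _, hi.integrableOn⟩ : IntegrableAtFilter u atTop) (fun s hs => by
      obtain ⟨b, hb⟩ := mem_atTop_sets.1 hs
      rw [← top_le_iff, ← Real.volume_Ici (a := b)]
      exact measure_mono hb) h1
  rwa [h2] at h1

theorem tendsto_atBot (hu : IsPrimitive u g) (hg : Integrable g) (hi : Integrable u) :
    Tendsto u atBot (𝓝 0) := by
  have h1 : Tendsto u atBot (𝓝 (u 0 - ∫ t in Iic 0, g t)) := by
    have e : u = fun x => u 0 - ∫ t in x..0, g t := by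
      funext x
      rw [hu.integral_eq]
      ring
    nth_rw 1 [e]
    exact (intervalIntegral_tendsto_integral_Iic 0 hg.integrableOn tendsto_id).const_sub _
  have h2 := IntegrableAtFilter.eq_zero_of_tendsto
    (⟨Iio 0, Iio_mem_atBot _, hi.integrableOn⟩ : IntegrableAtFilter u atBot) (fun s hs => by
      obtain ⟨b, hb⟩ := mem_atBot_sets.1 hs
      rw [← top_le_iff, ← Real.volume_Iic (a := b)]
      exact measure_mono hb) h1
  rwa [h2] at h1

theorem integral_Ioi (hu : IsPrimitive u g) (hg : Integrable g) (hi : Integrable u) (p : ℝ) :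
    ∫ t in Ioi p, g t = -u p := by
  refine tendsto_nhds_unique
    (intervalIntegral_tendsto_integral_Ioi p hg.integrableOn tendsto_id) ?_
  simpa [hu.integral_eq] using (hu.tendsto_atTop hg hi).sub_const (u p)

theorem integral_Iic (hu : IsPrimitive u g) (hg : Integrable g) (hi : Integrable u) (p : ℝ) :
    ∫ t in Iic p, g t = u p := by
  refine tendsto_nhds_unique
    (intervalIntegral_tendsto_integral_Iic p hg.integrableOn tendsto_id) ?_
  simpa [hu.integral_eq] using (hu.tendsto_atBot hg hi).const_sub (u p)

theorem mem_H1 (hu : IsPrimitive u g) (h2 : MemLp u 2 volume) (hg : MemLp g 2 volume) : u ∈ H1 :=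
  ⟨hu.continuous, h2, g, hu.isWeakDeriv, hg⟩

theorem weakDeriv_ae_eq (hu : IsPrimitive u g) : weakDeriv u =ᵐ[volume] g := by
  have h : ∃ g, IsWeakDeriv u g := ⟨g, hu.isWeakDeriv⟩
  rw [weakDeriv, dif_pos h]
  exact h.choose_spec.ae_eq hu.isWeakDeriv

end IsPrimitive

section H1

variable {u : ℝ → ℝ}

theorem isPrimitive_weakDeriv (hu : u ∈ H1) : IsPrimitive u (weakDeriv u) := by
  obtain ⟨hc, -, g, hg, -⟩ := hu
  have := hg.isPrimitive hc
  exact this.congr_ae this.weakDeriv_ae_eq.symm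

theorem memLp_weakDeriv (hu : u ∈ H1) : MemLp (weakDeriv u) 2 volume := by
  obtain ⟨hc, -, g, hg, h2⟩ := hu
  exact (memLp_congr_ae (hg.isPrimitive hc).weakDeriv_ae_eq).2 h2

theorem integrable_sq (hu : u ∈ H1) : Integrable (fun x => u x * u x) :=
  hu.2.1.integrable_mul hu.2.1

theorem integrable_mul_weakDeriv (hu : u ∈ H1) : Integrable (fun x => u x * weakDeriv u x) :=
  hu.2.1.integrable_mul (memLp_weakDeriv hu)

/-- The square u² and its derivative 2uu' are integrable, so u² tends to 0 at both ends and attains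
its positive maximum. -/
theorem exists_peak (hu : u ∈ H1) (h0 : u ≠ 0) : ∃ p, u p ≠ 0 ∧ ∀ x, |u x| ≤ |u p| := by
  obtain ⟨q, hq⟩ := Function.ne_iff.1 h0
  have hp := (isPrimitive_weakDeriv hu).mul (isPrimitive_weakDeriv hu)
  have hi : Integrable (fun x => weakDeriv u x * u x + u x * weakDeriv u x) := by
    refine Integrable.add ?_ (integrable_mul_weakDeriv hu)
    simpa [mul_comm] using integrable_mul_weakDeriv hu
  have ht : Tendsto (fun x => u x * u x) (cocompact ℝ) (𝓝 0) := by
    rw [cocompact_eq_atBot_atTop]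
    exact (hp.tendsto_atBot hi (integrable_sq hu)).sup (hp.tendsto_atTop hi (integrable_sq hu))
  have hq2 : 0 < u q * u q := mul_self_pos.2 hq
  obtain ⟨p, hpm⟩ := hp.continuous.exists_forall_ge' q
    ((ht.eventually (gt_mem_nhds hq2)).mono fun x hx => hx.le)
  refine ⟨p, fun h => ?_, fun x => sq_le_sq.1 ?_⟩
  · have := hpm q
    simp only [h] at this
    linarith
  · simpa [sq] using hpm x

theorem supNorm_eq_abs (hc : Continuous u) {p : ℝ} (hp : ∀ x, |u x| ≤ |u p|) :
    supNorm u = |u p| := by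
  have h1 : eLpNorm u ⊤ volume = ‖u p‖ₑ := by
    rw [eLpNorm_exponent_top]
    apply le_antisymm
    · refine essSup_le_of_ae_le _ (Eventually.of_forall fun x => ?_)
      simpa [enorm_le_iff_norm_le] using hp x
    -- An almost everywhere bound holds on a dense set, and by continuity on a closed one, hence
    -- everywhere.
    · have hd : Dense {x | ‖u x‖ₑ ≤ eLpNormEssSup u volume} :=
        Measure.dense_of_ae (μ := volume) (enorm_ae_le_eLpNormEssSup u volume)
      have hcl : IsClosed {x | ‖u x‖ₑ ≤ eLpNormEssSup u volume} :=
        isClosed_le hc.enorm continuous_const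
      have : p ∈ {x | ‖u x‖ₑ ≤ eLpNormEssSup u volume} := by
        rw [← hcl.closure_eq, hd.closure_eq]
        trivial
      exact this
  rw [supNorm, h1]
  simp

end H1

/-! ### Riccati equation and the energy identity -/

/-- A solution `r` of the Riccati equation `r' + r² = V` with bounded continuous data. -/
structure IsBoundedRiccati (V r : ℝ → ℝ) : Prop where
  hasDerivAt : ∀ x, HasDerivAt r (V x - r x ^ 2) x
  continuous_potential : Continuous V
  bounded_potential : ∃ C, ∀ x, |V x| ≤ C
  bounded : ∃ C, ∀ x, |r x| ≤ C

namespace IsBoundedRiccati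

variable {V r : ℝ → ℝ}

theorem continuous (h : IsBoundedRiccati V r) : Continuous r :=
  continuous_iff_continuousAt.2 fun x => (h.hasDerivAt x).continuousAt

theorem isPrimitive (h : IsBoundedRiccati V r) : IsPrimitive r (fun x => V x - r x ^ 2) :=
  .of_hasDerivAt h.hasDerivAt (h.continuous_potential.sub (h.continuous.pow 2))

end IsBoundedRiccati

theorem integrable_bounded_mul {r f : ℝ → ℝ} (hr : Measurable r) (hb : ∃ C, ∀ x, |r x| ≤ C)
    (hf : Integrable f) : Integrable (fun x => r x * f x) := by
  obtain ⟨C, hC⟩ := hb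
  exact hf.bdd_mul hr.aestronglyMeasurable (Eventually.of_forall fun x => by simpa using hC x)

section Riccati

variable {V r s u : ℝ → ℝ}

/-- The integrand is the derivative of r u², whose integrals over half-lines are the boundary terms
of the energy identity. -/
theorem integrable_riccati (hr : IsBoundedRiccati V r) (hu : u ∈ H1) :
    Integrable (fun x => (V x - r x ^ 2) * (u x * u x) +
      r x * (weakDeriv u x * u x + u x * weakDeriv u x)) := by
  have h1 := integrable_sq hu
  have h2 := integrable_mul_weakDeriv hu
  refine Integrable.add ?_ (integrable_bounded_mul hr.continuous.measurable hr.bounded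
    (Integrable.add (by simpa [mul_comm] using h2) h2))
  obtain ⟨C, hC⟩ := hr.bounded_potential
  obtain ⟨D, hD⟩ := hr.bounded
  refine integrable_bounded_mul
    (hr.continuous_potential.sub (hr.continuous.pow 2)).measurable ⟨C + D ^ 2, fun x => ?_⟩ h1
  have := pow_le_pow_left₀ (abs_nonneg _) (hD x) 2
  calc |V x - r x ^ 2| ≤ |V x| + |r x ^ 2| := abs_sub _ _
    _ ≤ _ := by rw [abs_pow]; linarith [hC x]

theorem integral_riccati_Ioi (hr : IsBoundedRiccati V r) (hu : u ∈ H1) (p : ℝ) :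
    ∫ x in Ioi p, ((V x - r x ^ 2) * (u x * u x) +
      r x * (weakDeriv u x * u x + u x * weakDeriv u x)) = -(r p * (u p * u p)) :=
  (hr.isPrimitive.mul ((isPrimitive_weakDeriv hu).mul (isPrimitive_weakDeriv hu))).integral_Ioi
    (integrable_riccati hr hu)
    (integrable_bounded_mul hr.continuous.measurable hr.bounded (integrable_sq hu)) p

theorem integral_riccati_Iic (hr : IsBoundedRiccati V r) (hu : u ∈ H1) (p : ℝ) :
    ∫ x in Iic p, ((V x - r x ^ 2) * (u x * u x) +
      r x * (weakDeriv u x * u x + u x * weakDeriv u x)) = r p * (u p * u p) :=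
  (hr.isPrimitive.mul ((isPrimitive_weakDeriv hu).mul (isPrimitive_weakDeriv hu))).integral_Iic
    (integrable_riccati hr hu)
    (integrable_bounded_mul hr.continuous.measurable hr.bounded (integrable_sq hu)) p

open Classical in
/-- The function equal to `s` on `(-∞, p)` and to `r` on `[p, ∞)`. -/
noncomputable def glue (p : ℝ) (s r : ℝ → ℝ) (x : ℝ) : ℝ := if x < p then s x else r x

theorem glue_of_lt {p x : ℝ} (h : x < p) : glue p s r x = s x := if_pos h

theorem glue_of_le {p x : ℝ} (h : p ≤ x) : glue p s r x = r x := if_neg h.not_gt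

theorem measurable_glue (p : ℝ) (hs : Measurable s) (hr : Measurable r) :
    Measurable (glue p s r) := Measurable.ite measurableSet_Iio hs hr

theorem bounded_glue (p : ℝ) (hs : ∃ C, ∀ x, |s x| ≤ C) (hr : ∃ C, ∀ x, |r x| ≤ C) :
    ∃ C, ∀ x, |glue p s r x| ≤ C := by
  obtain ⟨C, hC⟩ := hs
  obtain ⟨D, hD⟩ := hr
  refine ⟨max C D, fun x => ?_⟩
  rcases lt_or_ge x p with h | h
  · rw [glue_of_lt h]
    exact (hC x).trans (le_max_left _ _)
  · rw [glue_of_le h]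
    exact (hD x).trans (le_max_right _ _)

theorem memLp_glue_mul (hs : IsBoundedRiccati V s) (hr : IsBoundedRiccati V r)
    (hu : MemLp u 2 volume) (p : ℝ) : MemLp (fun x => glue p s r x * u x) 2 volume := by
  obtain ⟨C, hC⟩ := bounded_glue p hs.bounded hr.bounded
  have hm := measurable_glue p hs.continuous.measurable hr.continuous.measurable
  refine hu.of_le_mul (c := C) (hm.aestronglyMeasurable.mul hu.1)
    (Eventually.of_forall fun x => ?_)
  rw [norm_mul]
  exact mul_le_mul_of_nonneg_right (hC x) (norm_nonneg _)

theorem integrable_residual_sq (hs : IsBoundedRiccati V s) (hr : IsBoundedRiccati V r)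
    (hu : u ∈ H1) (p : ℝ) : Integrable (fun x => (weakDeriv u x - glue p s r x * u x) ^ 2) :=
  ((memLp_weakDeriv hu).sub (memLp_glue_mul hs hr hu.2.1 p)).integrable_sq

theorem energy_eq_residual_add (hs : IsBoundedRiccati V s) (hr : IsBoundedRiccati V r)
    (hu : u ∈ H1) (p : ℝ) :
    energy V u = (∫ x, (weakDeriv u x - glue p s r x * u x) ^ 2) + (s p - r p) * u p ^ 2 := by
  have hres := integrable_residual_sq hs hr hu p
  have hE : Integrable (fun x => weakDeriv u x ^ 2 + V x * u x ^ 2) := by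
    refine (memLp_weakDeriv hu).integrable_sq.add ?_
    simpa [sq] using integrable_bounded_mul hr.continuous_potential.measurable
      hr.bounded_potential (integrable_sq hu)
  have hD := hE.sub hres
  have h1 := integral_sub hE hres
  have h2 := integral_add_compl (measurableSet_Iio (a := p)) hD
  rw [compl_Iio] at h2
  have h3 : ∫ x in Iio p, (weakDeriv u x ^ 2 + V x * u x ^ 2 -
      (weakDeriv u x - glue p s r x * u x) ^ 2) = s p * (u p * u p) := by
    rw [← integral_riccati_Iic hs hu p, integral_Iic_eq_integral_Iio]
    refine setIntegral_congr_fun measurableSet_Iio fun x hx => ?_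
    simp only [glue_of_lt hx]
    ring
  have h4 : ∫ x in Ici p, (weakDeriv u x ^ 2 + V x * u x ^ 2 -
      (weakDeriv u x - glue p s r x * u x) ^ 2) = -(r p * (u p * u p)) := by
    rw [← integral_riccati_Ioi hr hu p, ← integral_Ici_eq_integral_Ioi]
    refine setIntegral_congr_fun measurableSet_Ici fun x hx => ?_
    simp only [glue_of_le hx]
    ring
  simp only [Pi.sub_apply] at h2
  rw [h3, h4, h1] at h2
  rw [energy]
  linarith

theorem gap_mul_sq_le_energy (hs : IsBoundedRiccati V s) (hr : IsBoundedRiccati V r)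
    (hu : u ∈ H1) (p : ℝ) : (s p - r p) * u p ^ 2 ≤ energy V u := by
  rw [energy_eq_residual_add hs hr hu p]
  have : 0 ≤ ∫ x, (weakDeriv u x - glue p s r x * u x) ^ 2 :=
    integral_nonneg fun x => sq_nonneg _
  linarith

theorem energy_eq_gap_mul_sq (hs : IsBoundedRiccati V s) (hr : IsBoundedRiccati V r)
    (hu : u ∈ H1) {p : ℝ} (h : IsPrimitive u (fun x => glue p s r x * u x)) :
    energy V u = (s p - r p) * u p ^ 2 := by
  rw [energy_eq_residual_add hs hr hu p, integral_eq_zero_of_ae, zero_add]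
  filter_upwards [h.weakDeriv_ae_eq] with x hx
  simp [hx]

theorem isPrimitive_of_energy_le (hs : IsBoundedRiccati V s) (hr : IsBoundedRiccati V r)
    (hu : u ∈ H1) {p : ℝ} (h : energy V u ≤ (s p - r p) * u p ^ 2) :
    IsPrimitive u (fun x => glue p s r x * u x) := by
  have hres := integrable_residual_sq hs hr hu p
  have h0 : ∫ x, (weakDeriv u x - glue p s r x * u x) ^ 2 = 0 := by
    rw [energy_eq_residual_add hs hr hu p] at h
    exact le_antisymm (by linarith) (integral_nonneg fun x => sq_nonneg _)
  rw [integral_eq_zero_iff_of_nonneg (fun x => sq_nonneg _) hres] at h0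
  refine (isPrimitive_weakDeriv hu).congr_ae ?_
  filter_upwards [h0] with x hx
  simpa [sub_eq_zero] using hx

/-- Agreement at `p` rules out a jump; integrals based at `p` see only one branch each. -/
theorem glue_isPrimitive {f g f' g' : ℝ → ℝ} {p : ℝ} (hf : IsPrimitive f f')
    (hg : IsPrimitive g g') (hfg : f p = g p) : IsPrimitive (glue p f g) (glue p f' g') := by
  have hl : LocallyIntegrable (glue p f' g') volume := by
    have e : glue p f' g' = (Iio p).indicator f' + (Ici p).indicator g' := by
      funext x
      rcases lt_or_ge x p with h | h
      · simp [glue_of_lt h, h]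
      · simp [glue_of_le h, h]
    rw [e]
    exact (hf.locallyIntegrable.indicator measurableSet_Iio).add
      (hg.locallyIntegrable.indicator measurableSet_Ici)
  have hii : ∀ a b, IntervalIntegrable (glue p f' g') volume a b := fun a b =>
    intervalIntegrable_iff.mpr <|
      (hl.integrableOn_isCompact isCompact_uIcc).mono_set uIoc_subset_uIcc
  have base : ∀ y, ∫ t in p..y, glue p f' g' t = glue p f g y - g p := by
    intro y
    rcases lt_or_ge y p with h | h
    · rw [glue_of_lt h, ← hfg, ← hf.integral_eq]
      refine intervalIntegral.integral_congr_ae ?_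
      filter_upwards [Measure.ae_ne volume p] with t ht hm
      rw [uIoc_of_ge h.le] at hm
      exact glue_of_lt (lt_of_le_of_ne hm.2 ht)
    · rw [glue_of_le h, ← hg.integral_eq]
      refine intervalIntegral.integral_congr fun t hm => ?_
      rw [uIcc_of_le h] at hm
      exact glue_of_le hm.1
  refine ⟨hl, fun x y => ?_⟩
  rw [← intervalIntegral.integral_interval_sub_left (hii p y) (hii p x), base, base]
  ring

variable {φ ψ : ℝ → ℝ} {p : ℝ}

theorem isPrimitive_glue_mul (hs : IsBoundedRiccati V s) (hr : IsBoundedRiccati V r)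
    (hψ : ∀ x, HasDerivAt ψ (s x * ψ x) x) (hφ : ∀ x, HasDerivAt φ (r x * φ x) x)
    (hψ0 : ψ p ≠ 0) (hφ0 : φ p ≠ 0) :
    IsPrimitive (glue p (fun x => ψ x / ψ p) (fun x => φ x / φ p))
      (fun x => glue p s r x * glue p (fun x => ψ x / ψ p) (fun x => φ x / φ p) x) := by
  have cψ : Continuous ψ := continuous_iff_continuousAt.2 fun x => (hψ x).continuousAt
  have cφ : Continuous φ := continuous_iff_continuousAt.2 fun x => (hφ x).continuousAt
  have h1 : IsPrimitive (fun x => ψ x / ψ p) (fun x => s x * ψ x / ψ p) :=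
    .of_hasDerivAt (fun x => (hψ x).div_const _) ((hs.continuous.mul cψ).div_const _)
  have h2 : IsPrimitive (fun x => φ x / φ p) (fun x => r x * φ x / φ p) :=
    .of_hasDerivAt (fun x => (hφ x).div_const _) ((hr.continuous.mul cφ).div_const _)
  have h3 := glue_isPrimitive (p := p) h1 h2 (by simp [hψ0, hφ0])
  convert h3 using 1
  funext x
  rcases lt_or_ge x p with h | h
  · simp only [glue_of_lt h, mul_div_assoc]
  · simp only [glue_of_le h, mul_div_assoc]

/-- On each side of `p`, the quotient of `u` by ψ or φ has zero derivative almost everywhere and is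
a primitive of it, hence constant. -/
theorem eq_mul_glue_of_isPrimitive (hs : IsBoundedRiccati V s) (hr : IsBoundedRiccati V r)
    (hψ : ∀ x, HasDerivAt ψ (s x * ψ x) x) (hφ : ∀ x, HasDerivAt φ (r x * φ x) x)
    (hψ0 : ∀ x, ψ x ≠ 0) (hφ0 : ∀ x, φ x ≠ 0)
    (h : IsPrimitive u (fun x => glue p s r x * u x)) :
    u = fun x => u p * glue p (fun x => ψ x / ψ p) (fun x => φ x / φ p) x := by
  have inv : ∀ {q χ : ℝ → ℝ}, Continuous q → (∀ x, HasDerivAt χ (q x * χ x) x) →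
      (∀ x, χ x ≠ 0) → IsPrimitive (fun x => (χ x)⁻¹) (fun x => -q x * (χ x)⁻¹) := by
    intro q χ hq hχ h0
    have c : Continuous χ := continuous_iff_continuousAt.2 fun x => (hχ x).continuousAt
    refine .of_hasDerivAt (fun x => ?_) (hq.neg.mul (c.inv₀ h0))
    refine ((hχ x).fun_inv (h0 x)).congr_deriv ?_
    have := h0 x
    field_simp
  funext x
  rcases lt_or_ge x p with hx | hx
  · have hz := (h.mul (inv hs.continuous hψ hψ0)).integral_eq x p
    rw [intervalIntegral.integral_zero_ae] at hz
    · simp only [glue_of_lt hx]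
      have := hψ0 x
      have := hψ0 p
      field_simp at hz ⊢
      linarith
    · filter_upwards [Measure.ae_ne volume p] with t ht hm
      rw [uIoc_of_le hx.le] at hm
      rw [glue_of_lt (lt_of_le_of_ne hm.2 ht)]
      ring
  · have hz := (h.mul (inv hr.continuous hφ hφ0)).integral_eq p x
    rw [intervalIntegral.integral_zero_ae] at hz
    · simp only [glue_of_le hx]
      have := hφ0 x
      have := hφ0 p
      field_simp at hz ⊢
      linarith
    · refine Eventually.of_forall fun t hm => ?_
      rw [uIoc_of_le hx] at hm
      rw [glue_of_le hm.1.le]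
      ring

end Riccati

/-! ### Minimizers from a strict minimum of the gap -/

section Variational

variable {V r s φ ψ : ℝ → ℝ} {p : ℝ}

theorem memLp_two_of_abs_le_exp {u : ℝ → ℝ} (hu : Continuous u) {C b : ℝ} (hb : 0 < b)
    (h : ∀ x, |u x| ≤ C * Real.exp (-(b * |x|))) : MemLp u 2 volume := by
  have hi : Integrable (fun x : ℝ => Real.exp (-(2 * b * |x|))) := by
    rw [← integrableOn_univ, ← Iic_union_Ioi (a := (0 : ℝ))]
    refine IntegrableOn.union ?_ ?_
    · refine (integrableOn_exp_mul_Iic (a := 2 * b) (by positivity) 0).congr_fun (fun x hx => ?_)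
        measurableSet_Iic
      simp only [abs_of_nonpos (mem_Iic.1 hx)]
      congr 1
      ring
    · refine (integrableOn_exp_mul_Ioi (a := -(2 * b)) (by linarith) 0).congr_fun
        (fun x hx => ?_) measurableSet_Ioi
      simp only [abs_of_pos (mem_Ioi.1 hx)]
      congr 1
      ring
  rw [memLp_two_iff_integrable_sq hu.aestronglyMeasurable]
  refine (hi.const_mul (C ^ 2)).mono' (hu.pow 2).aestronglyMeasurable
    (Eventually.of_forall fun x => ?_)
  have := pow_le_pow_left₀ (abs_nonneg _) (h x) 2
  rwa [mul_pow, ← Real.exp_nat_mul,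
    show ((2 : ℕ) : ℝ) * -(b * |x|) = -(2 * b * |x|) by push_cast; ring, ← abs_pow] at this

/-- The peak `p` strictly minimizes `s - r`, where `s` and `r` are the logarithmic derivatives of
the positive solutions `ψ` and `φ` of `u'' = V u`. -/
structure PeakData (V s r ψ φ : ℝ → ℝ) (p : ℝ) : Prop where
  left : IsBoundedRiccati V s
  right : IsBoundedRiccati V r
  hasDerivAt_left : ∀ x, HasDerivAt ψ (s x * ψ x) x
  hasDerivAt_right : ∀ x, HasDerivAt φ (r x * φ x) x
  left_ne : ∀ x, ψ x ≠ 0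
  right_ne : ∀ x, φ x ≠ 0
  gap_pos : 0 < s p - r p
  gap_lt : ∀ x, x ≠ p → s p - r p < s x - r x
  memLp : MemLp (glue p (fun x => ψ x / ψ p) (fun x => φ x / φ p)) 2 volume

/-- The solution glued at `p`, normalized to `1` there. -/
noncomputable def gluedPeak (ψ φ : ℝ → ℝ) (p : ℝ) : ℝ → ℝ :=
  glue p (fun x => ψ x / ψ p) (fun x => φ x / φ p)

namespace PeakData

variable {w : ℝ → ℝ}

theorem isPrimitive (h : PeakData V s r ψ φ p) :
    IsPrimitive (gluedPeak ψ φ p) (fun x => glue p s r x * gluedPeak ψ φ p x) :=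
  isPrimitive_glue_mul h.left h.right h.hasDerivAt_left h.hasDerivAt_right (h.left_ne p)
    (h.right_ne p)

theorem mem_H1 (h : PeakData V s r ψ φ p) : gluedPeak ψ φ p ∈ H1 :=
  h.isPrimitive.mem_H1 h.memLp (memLp_glue_mul h.left h.right h.memLp p)

theorem apply_peak (h : PeakData V s r ψ φ p) : gluedPeak ψ φ p p = 1 := by
  rw [gluedPeak, glue_of_le le_rfl, div_self (h.right_ne p)]

theorem gap_le (h : PeakData V s r ψ φ p) (x : ℝ) : s p - r p ≤ s x - r x := by
  rcases eq_or_ne x p with rfl | hx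
  · exact le_rfl
  · exact (h.gap_lt x hx).le

theorem eq_smul_gluedPeak (h : PeakData V s r ψ φ p) (hw : w ∈ H1)
    (hE : energy V w ≤ (s p - r p) * w p ^ 2) : w = fun x => w p * gluedPeak ψ φ p x :=
  eq_mul_glue_of_isPrimitive h.left h.right h.hasDerivAt_left h.hasDerivAt_right h.left_ne
    h.right_ne (isPrimitive_of_energy_le h.left h.right hw hE)

theorem smul_mem_H1 (h : PeakData V s r ψ φ p) (c : ℝ) :
    (fun x => c * gluedPeak ψ φ p x) ∈ H1 :=
  (h.isPrimitive.const_mul c).mem_H1 (h.memLp.const_mul c)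
    ((memLp_glue_mul h.left h.right h.memLp p).const_mul c)

theorem energy_smul (h : PeakData V s r ψ φ p) (c : ℝ) :
    energy V (fun x => c * gluedPeak ψ φ p x) = (s p - r p) * c ^ 2 := by
  rw [energy_eq_gap_mul_sq h.left h.right (h.smul_mem_H1 c) (p := p), h.apply_peak, mul_one]
  convert h.isPrimitive.const_mul c using 2
  ring

theorem energy_gluedPeak (h : PeakData V s r ψ φ p) :
    energy V (gluedPeak ψ φ p) = s p - r p := by
  simpa using h.energy_smul 1

/-- With v the glued function, the energy bound at `x` gives gap(x) v(x)² ≤ gap(p) ≤ gap(x); no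
monotonicity of the branches is needed. -/
theorem abs_gluedPeak_le (h : PeakData V s r ψ φ p) (x : ℝ) : |gluedPeak ψ φ p x| ≤ 1 := by
  rw [← sq_le_one_iff_abs_le_one]
  have h1 := gap_mul_sq_le_energy h.left h.right h.mem_H1 x
  rw [h.energy_gluedPeak] at h1
  have h2 := mul_le_mul_of_nonneg_right (h.gap_le x) (sq_nonneg (gluedPeak ψ φ p x))
  exact le_of_mul_le_mul_left (by linarith) h.gap_pos

theorem supNorm_smul (h : PeakData V s r ψ φ p) (c : ℝ) :
    supNorm (fun x => c * gluedPeak ψ φ p x) = |c| := by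
  rw [supNorm_eq_abs (p := p) (h.smul_mem_H1 c).1]
  · rw [h.apply_peak, mul_one]
  · intro x
    rw [h.apply_peak, mul_one, abs_mul]
    exact mul_le_of_le_one_right (abs_nonneg c) (h.abs_gluedPeak_le x)

theorem isPeakMinimizer_iff (h : PeakData V s r ψ φ p) :
    IsPeakMinimizer V p w ↔ w = gluedPeak ψ φ p := by
  have hmem : gluedPeak ψ φ p ∈ peakSet p :=
    ⟨h.mem_H1, h.apply_peak, by simpa using h.supNorm_smul 1⟩
  constructor
  · rintro ⟨⟨hw, hp, -⟩, hmin⟩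
    have hE := hmin _ hmem
    rw [h.energy_gluedPeak] at hE
    have := h.eq_smul_gluedPeak hw (by rw [hp]; linarith)
    simpa [hp] using this
  · rintro rfl
    refine ⟨hmem, fun w hw => ?_⟩
    have := gap_mul_sq_le_energy h.left h.right hw.1 p
    rw [hw.2.1] at this
    rw [h.energy_gluedPeak]
    linarith

theorem rayleigh_smul (h : PeakData V s r ψ φ p) {c : ℝ} (hc : c ≠ 0) :
    rayleigh V (fun x => c * gluedPeak ψ φ p x) = s p - r p := by
  rw [rayleigh, h.energy_smul, h.supNorm_smul, sq_abs]
  field_simp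

theorem smul_ne_zero (h : PeakData V s r ψ φ p) {c : ℝ} (hc : c ≠ 0) :
    (fun x => c * gluedPeak ψ φ p x) ≠ 0 := fun h0 => hc <| by
  simpa [h.apply_peak] using congrFun h0 p

theorem gap_le_rayleigh (h : PeakData V s r ψ φ p) (hw : w ∈ H1) (h0 : w ≠ 0) :
    s p - r p ≤ rayleigh V w := by
  obtain ⟨q, hq, hm⟩ := exists_peak hw h0
  have hq2 : 0 < w q ^ 2 := by positivity
  rw [rayleigh, supNorm_eq_abs hw.1 hm, sq_abs, le_div_iff₀ hq2]
  exact (mul_le_mul_of_nonneg_right (h.gap_le q) hq2.le).trans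
    (gap_mul_sq_le_energy h.left h.right hw q)

/-- If `w` peaked at some q ≠ p, the energy bound at q would exceed the minimum strictly. -/
theorem eq_smul_of_rayleigh_eq (h : PeakData V s r ψ φ p) (hw : w ∈ H1) (h0 : w ≠ 0)
    (hR : rayleigh V w = s p - r p) : w p ≠ 0 ∧ w = fun x => w p * gluedPeak ψ φ p x := by
  obtain ⟨q, hq, hm⟩ := exists_peak hw h0
  have hq2 : 0 < w q ^ 2 := by positivity
  rw [rayleigh, supNorm_eq_abs hw.1 hm, sq_abs, div_eq_iff hq2.ne'] at hR
  have hqp : q = p := by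
    by_contra hne
    have h1 := mul_lt_mul_of_pos_right (h.gap_lt q hne) hq2
    have h2 := gap_mul_sq_le_energy h.left h.right hw q
    linarith
  rw [hqp] at hR hq
  exact ⟨hq, h.eq_smul_gluedPeak hw hR.le⟩

theorem bestQuantity_eq (h : PeakData V s r ψ φ p) : bestQuantity V = s p - r p := by
  apply IsLeast.csInf_eq
  refine ⟨⟨fun x => 1 * gluedPeak ψ φ p x, ⟨h.smul_mem_H1 1, h.smul_ne_zero one_ne_zero⟩,
    h.rayleigh_smul one_ne_zero⟩, ?_⟩
  rintro _ ⟨w, ⟨hw, h0⟩, rfl⟩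
  exact h.gap_le_rayleigh hw h0

theorem minimizers_eq (h : PeakData V s r ψ φ p) :
    minimizers V = {v | ∃ c : ℝ, c ≠ 0 ∧ v = fun x => c * gluedPeak ψ φ p x} := by
  ext v
  constructor
  · rintro ⟨hv, h0, hR⟩
    rw [h.bestQuantity_eq] at hR
    exact ⟨v p, h.eq_smul_of_rayleigh_eq hv h0 hR.symm⟩
  · rintro ⟨c, hc, rfl⟩
    exact ⟨h.smul_mem_H1 c, h.smul_ne_zero hc, by rw [h.bestQuantity_eq, h.rayleigh_smul hc]⟩

end PeakData

end Variational

/-! ### The explicit potential and its two solutions -/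

/-- The logarithmic derivative of `phiPlus`. -/
noncomputable def slopePlus (A B x : ℝ) : ℝ := -B - x / (x ^ 2 + A ^ 2)

/-- The quadratic polynomial in the numerator of `phiMinus`. -/
def quadMinus (A B x : ℝ) : ℝ := 2 * B ^ 2 * x ^ 2 - 2 * B * x + 2 * A ^ 2 * B ^ 2 + 1

/-- The logarithmic derivative of `phiMinus`. -/
noncomputable def slopeMinus (A B x : ℝ) : ℝ :=
  B - x / (x ^ 2 + A ^ 2) + (4 * B ^ 2 * x - 2 * B) / quadMinus A B x

/-- The closed form of the potential. -/
noncomputable def potentialFormula (A B x : ℝ) : ℝ :=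
  ((B * (x ^ 2 + A ^ 2) + x) ^ 2 + x ^ 2 - A ^ 2) / (x ^ 2 + A ^ 2) ^ 2

variable {A B : ℝ}

theorem half_le_quadMinus (A B x : ℝ) : 1 / 2 ≤ quadMinus A B x := by
  unfold quadMinus
  nlinarith [sq_nonneg (2 * B * x - 1), sq_nonneg (A * B)]

theorem quadMinus_pos (A B x : ℝ) : 0 < quadMinus A B x :=
  lt_of_lt_of_le (by norm_num) (half_le_quadMinus A B x)

theorem sq_add_sq_pos (hA : 0 < A) (x : ℝ) : 0 < x ^ 2 + A ^ 2 := by positivity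

theorem hasDerivAt_sq_add (A x : ℝ) : HasDerivAt (fun x : ℝ => x ^ 2 + A ^ 2) (2 * x) x := by
  simpa using (hasDerivAt_pow 2 x).add_const (A ^ 2)

theorem hasDerivAt_quadMinus (A B x : ℝ) :
    HasDerivAt (quadMinus A B) (4 * B ^ 2 * x - 2 * B) x := by
  have h1 := (hasDerivAt_pow 2 x).const_mul (2 * B ^ 2)
  have h2 := (hasDerivAt_id x).const_mul (2 * B)
  have h3 := ((h1.sub h2).add_const (2 * A ^ 2 * B ^ 2)).add_const 1
  refine h3.congr_deriv ?_
  push_cast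
  ring

theorem hasDerivAt_slopePlus (hA : 0 < A) (B x : ℝ) :
    HasDerivAt (slopePlus A B) (potentialFormula A B x - slopePlus A B x ^ 2) x := by
  have hs := (sq_add_sq_pos hA x).ne'
  have h := ((hasDerivAt_id x).fun_div (hasDerivAt_sq_add A x) hs).const_sub (-B)
  refine h.congr_deriv ?_
  unfold potentialFormula slopePlus
  simp only [id]
  field_simp
  ring

theorem hasDerivAt_slopeMinus (hA : 0 < A) (B x : ℝ) :
    HasDerivAt (slopeMinus A B) (potentialFormula A B x - slopeMinus A B x ^ 2) x := by
  have hs := (sq_add_sq_pos hA x).ne'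
  have hq := (quadMinus_pos A B x).ne'
  have hl : HasDerivAt (fun x : ℝ => 4 * B ^ 2 * x - 2 * B) (4 * B ^ 2) x := by
    simpa using ((hasDerivAt_id x).const_mul (4 * B ^ 2)).sub_const (2 * B)
  have h := (((hasDerivAt_id x).fun_div (hasDerivAt_sq_add A x) hs).const_sub B).add
    (hl.fun_div (hasDerivAt_quadMinus A B x) hq)
  refine h.congr_deriv ?_
  unfold potentialFormula slopeMinus
  simp only [id]
  field_simp
  unfold quadMinus
  ring

theorem hasDerivAt_sqrt_sq_add (hA : 0 < A) (x : ℝ) :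
    HasDerivAt (fun x : ℝ => √(x ^ 2 + A ^ 2)) (x / √(x ^ 2 + A ^ 2)) x := by
  refine ((hasDerivAt_sq_add A x).sqrt (sq_add_sq_pos hA x).ne').congr_deriv ?_
  rw [mul_div_mul_left _ _ two_ne_zero]

theorem phiPlus_pos (hA : 0 < A) (B x : ℝ) : 0 < phiPlus A B x := by
  unfold phiPlus
  positivity

theorem phiMinus_eq (A B x : ℝ) : phiMinus A B x =
    A * quadMinus A B x * Real.exp (B * x) / ((2 * A ^ 2 * B ^ 2 + 1) * √(x ^ 2 + A ^ 2)) := rfl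

theorem phiMinus_pos (hA : 0 < A) (B x : ℝ) : 0 < phiMinus A B x := by
  have := quadMinus_pos A B x
  rw [phiMinus_eq]
  positivity

theorem hasDerivAt_phiPlus (hA : 0 < A) (B x : ℝ) :
    HasDerivAt (phiPlus A B) (slopePlus A B x * phiPlus A B x) x := by
  have hp := sq_add_sq_pos hA x
  have hσ : 0 < √(x ^ 2 + A ^ 2) := Real.sqrt_pos.2 hp
  have hsq : √(x ^ 2 + A ^ 2) ^ 2 = x ^ 2 + A ^ 2 := Real.sq_sqrt hp.le
  have he : HasDerivAt (fun x : ℝ => A * Real.exp (-(B * x))) (A * (Real.exp (-(B * x)) * -B)) x := by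
    simpa using (((hasDerivAt_id x).const_mul B).neg.exp).const_mul A
  refine (he.fun_div (hasDerivAt_sqrt_sq_add hA x) hσ.ne').congr_deriv ?_
  unfold slopePlus phiPlus
  -- Everything is expressed through the square root σ. This rewriting also changes the argument of
  -- the root, which the next one restores.
  rw [← hsq]
  rw [Real.sqrt_sq hσ.le]
  field_simp

theorem hasDerivAt_phiMinus (hA : 0 < A) (B x : ℝ) :
    HasDerivAt (phiMinus A B) (slopeMinus A B x * phiMinus A B x) x := by
  have hp := sq_add_sq_pos hA x
  have hσ : 0 < √(x ^ 2 + A ^ 2) := Real.sqrt_pos.2 hp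
  have hsq : √(x ^ 2 + A ^ 2) ^ 2 = x ^ 2 + A ^ 2 := Real.sq_sqrt hp.le
  have hq := (quadMinus_pos A B x).ne'
  have hc : 0 < 2 * A ^ 2 * B ^ 2 + 1 := by positivity
  have he : HasDerivAt (fun x : ℝ => Real.exp (B * x)) (Real.exp (B * x) * B) x := by
    simpa using ((hasDerivAt_id x).const_mul B).exp
  refine ((((hasDerivAt_quadMinus A B x).const_mul A).mul he).fun_div
    ((hasDerivAt_sqrt_sq_add hA x).const_mul (2 * A ^ 2 * B ^ 2 + 1))
    (mul_pos hc hσ).ne').congr_deriv ?_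
  rw [phiMinus_eq]
  unfold slopeMinus
  rw [← hsq]
  rw [Real.sqrt_sq hσ.le]
  simp only [Pi.mul_apply]
  field_simp
  ring

theorem potential_eq (hA : 0 < A) (B : ℝ) : potential A B = potentialFormula A B := by
  have h1 : deriv (ellPlus A B) = slopePlus A B := by
    funext x
    have := ((hasDerivAt_phiPlus hA B x).log (phiPlus_pos hA B x).ne').deriv
    rw [mul_div_cancel_right₀ _ (phiPlus_pos hA B x).ne'] at this
    exact this
  funext x
  rw [potential, h1, (hasDerivAt_slopePlus hA B x).deriv]
  ring

theorem abs_div_sq_add_le (hA : 0 < A) (x : ℝ) : |x / (x ^ 2 + A ^ 2)| ≤ 1 / A := by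
  have hp := sq_add_sq_pos hA x
  rw [abs_div, abs_of_pos hp, div_le_div_iff₀ hp hA]
  nlinarith [sq_nonneg (|x| - A), sq_abs x, sq_nonneg x, sq_nonneg (|x| + A), abs_nonneg x]

theorem potentialFormula_eq (hA : 0 < A) (B x : ℝ) : potentialFormula A B x =
    (B + x / (x ^ 2 + A ^ 2)) ^ 2 + (x ^ 2 - A ^ 2) / (x ^ 2 + A ^ 2) ^ 2 := by
  have hp := (sq_add_sq_pos hA x).ne'
  unfold potentialFormula
  field_simp
  ring

theorem abs_potentialFormula_le (hA : 0 < A) (B x : ℝ) :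
    |potentialFormula A B x| ≤ (|B| + 1 / A) ^ 2 + 1 / A ^ 2 := by
  have hp := sq_add_sq_pos hA x
  rw [potentialFormula_eq hA]
  refine (abs_add_le _ _).trans (add_le_add ?_ ?_)
  · rw [abs_pow]
    exact pow_le_pow_left₀ (abs_nonneg _)
      ((abs_add_le _ _).trans (by linarith [abs_div_sq_add_le hA x])) 2
  · rw [abs_div, abs_of_pos (pow_pos hp 2), div_le_div_iff₀ (by positivity) (by positivity)]
    have h1 : |x ^ 2 - A ^ 2| ≤ x ^ 2 + A ^ 2 :=
      abs_le.2 ⟨by linarith [sq_nonneg x], by linarith [sq_nonneg A]⟩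
    nlinarith [mul_le_mul h1 (show A ^ 2 ≤ x ^ 2 + A ^ 2 by linarith [sq_nonneg x])
      (sq_nonneg A) hp.le]

/-- The two variable terms are bounded separately: 2x/(x² + A²) is smallest at x = −A, and the last
term at x = 0. -/
theorem le_potentialFormula (hA : 0 < A) (hB : 0 < B) (x : ℝ) :
    (A ^ 2 * B ^ 2 - A * B - 1) / A ^ 2 ≤ potentialFormula A B x := by
  have hp := sq_add_sq_pos hA x
  have e : potentialFormula A B x = B ^ 2 + B * (2 * x / (x ^ 2 + A ^ 2)) +
      (2 * x ^ 2 - A ^ 2) / (x ^ 2 + A ^ 2) ^ 2 := by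
    unfold potentialFormula
    field_simp
    ring
  have h1 : -(1 / A) ≤ 2 * x / (x ^ 2 + A ^ 2) := by
    rw [← neg_div, div_le_div_iff₀ hA hp]
    nlinarith [sq_nonneg (x + A)]
  have h2 : -(1 / A ^ 2) ≤ (2 * x ^ 2 - A ^ 2) / (x ^ 2 + A ^ 2) ^ 2 := by
    rw [← neg_div, div_le_div_iff₀ (by positivity) (by positivity)]
    nlinarith [mul_nonneg (sq_nonneg x) (sq_nonneg A), sq_nonneg (x ^ 2)]
  have h3 := mul_le_mul_of_nonneg_left h1 hB.le
  rw [e]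
  have e2 : (A ^ 2 * B ^ 2 - A * B - 1) / A ^ 2 = B ^ 2 + B * -(1 / A) + -(1 / A ^ 2) := by
    field_simp
    ring
  rw [e2]
  linarith

theorem continuous_potentialFormula (hA : 0 < A) (B : ℝ) : Continuous (potentialFormula A B) := by
  unfold potentialFormula
  exact Continuous.div (by fun_prop) (by fun_prop) fun x => (pow_pos (sq_add_sq_pos hA x) 2).ne'

theorem isBoundedRiccati_slopePlus (hA : 0 < A) (B : ℝ) :
    IsBoundedRiccati (potentialFormula A B) (slopePlus A B) where
  hasDerivAt := hasDerivAt_slopePlus hA B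
  continuous_potential := continuous_potentialFormula hA B
  bounded_potential := ⟨_, abs_potentialFormula_le hA B⟩
  bounded := ⟨|B| + 1 / A, fun x => by
    unfold slopePlus
    refine (abs_sub _ _).trans ?_
    rw [abs_neg]
    linarith [abs_div_sq_add_le hA x]⟩

theorem isBoundedRiccati_slopeMinus (hA : 0 < A) (hB : 0 < B) :
    IsBoundedRiccati (potentialFormula A B) (slopeMinus A B) where
  hasDerivAt := hasDerivAt_slopeMinus hA B
  continuous_potential := continuous_potentialFormula hA B
  bounded_potential := ⟨_, abs_potentialFormula_le hA B⟩
  bounded := ⟨B + 1 / A + 12 * B, fun x => by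
    have hq := quadMinus_pos A B x
    have h1 : |(4 * B ^ 2 * x - 2 * B) / quadMinus A B x| ≤ 12 * B := by
      rw [abs_div, abs_of_pos hq, div_le_iff₀ hq,
        show 4 * B ^ 2 * x - 2 * B = B * (4 * (B * x) - 2) by ring, abs_mul, abs_of_pos hB,
        show 12 * B * quadMinus A B x = B * (12 * quadMinus A B x) by ring]
      refine mul_le_mul_of_nonneg_left ?_ hB.le
      unfold quadMinus
      rw [abs_le]
      constructor <;> nlinarith [sq_nonneg (B * x), sq_nonneg (B * x - 1), sq_nonneg (A * B),
        sq_nonneg (2 * (B * x) - 1)]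
    unfold slopeMinus
    refine (abs_add_le _ _).trans (add_le_add ((abs_sub _ _).trans ?_) h1)
    rw [abs_of_pos hB]
    linarith [abs_div_sq_add_le hA x]⟩

/-- For B > 0, reduction of order explains the form: `phiMinus` is a constant multiple of `phiPlus`
times the integral of `phiPlus`⁻² over (−∞, x), and that integral is e^{2Bx} `quadMinus A B
x`/(4A²B³). The gap is its logarithmic derivative. -/
theorem slopeMinus_sub_slopePlus (hA : 0 < A) (B x : ℝ) : slopeMinus A B x - slopePlus A B x =
    4 * B ^ 3 * (x ^ 2 + A ^ 2) / quadMinus A B x := by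
  have hq := (quadMinus_pos A B x).ne'
  have hp := (sq_add_sq_pos hA x).ne'
  unfold slopeMinus slopePlus
  field_simp
  unfold quadMinus
  ring

theorem sqrt_eq_one_sub_peakPoint (A : ℝ) (hB : 0 < B) :
    √(1 + 4 * A ^ 2 * B ^ 2) = 1 - 2 * B * peakPoint A B := by
  unfold peakPoint
  field_simp
  ring

/-- This is the critical point equation of the gap; `peakPoint` is its negative root. -/
theorem peakPoint_quadratic (A : ℝ) (hB : 0 < B) :
    B * peakPoint A B ^ 2 - peakPoint A B - B * A ^ 2 = 0 := by
  have h : √(1 + 4 * A ^ 2 * B ^ 2) ^ 2 = 1 + 4 * A ^ 2 * B ^ 2 := Real.sq_sqrt (by positivity)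
  rw [sqrt_eq_one_sub_peakPoint A hB] at h
  have : 4 * B * (B * peakPoint A B ^ 2 - peakPoint A B - B * A ^ 2) = 0 := by linarith
  simpa [hB.ne'] using this

theorem peakPoint_neg (hA : 0 < A) (hB : 0 < B) : peakPoint A B < 0 := by
  have h : 1 < √(1 + 4 * A ^ 2 * B ^ 2) := by
    rw [Real.lt_sqrt zero_le_one]
    nlinarith [pow_pos (mul_pos hA hB) 2]
  rw [sqrt_eq_one_sub_peakPoint A hB] at h
  nlinarith

theorem gap_lt_of_ne (hA : 0 < A) (hB : 0 < B) {x : ℝ} (hx : x ≠ peakPoint A B) :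
    slopeMinus A B (peakPoint A B) - slopePlus A B (peakPoint A B) <
      slopeMinus A B x - slopePlus A B x := by
  rw [slopeMinus_sub_slopePlus hA, slopeMinus_sub_slopePlus hA,
    div_lt_div_iff₀ (quadMinus_pos _ _ _) (quadMinus_pos _ _ _)]
  have h0 := peakPoint_quadratic A hB
  have hneg := peakPoint_neg hA hB
  set a := peakPoint A B
  have h1 : 0 < 4 * B ^ 3 * ((1 - 2 * B * a) * (x - a) ^ 2) := by
    have h2 : 0 < 1 - 2 * B * a := by nlinarith
    have h3 : 0 < (x - a) ^ 2 := by
      have := sub_ne_zero.2 hx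
      positivity
    positivity
  -- After cross-multiplication the difference is quadratic in x, and the equation for a makes a a
  -- double root.
  have key : 4 * B ^ 3 * (x ^ 2 + A ^ 2) * quadMinus A B a -
      4 * B ^ 3 * (a ^ 2 + A ^ 2) * quadMinus A B x =
      4 * B ^ 3 * ((1 - 2 * B * a) * (x - a) ^ 2) := by
    unfold quadMinus
    linear_combination (-8 * B ^ 3 * (x - a)) * h0
  linarith

theorem gap_peakPoint (hA : 0 < A) (hB : 0 < B) :
    slopeMinus A B (peakPoint A B) - slopePlus A B (peakPoint A B) =
      2 * B * (1 - 1 / √(1 + 4 * A ^ 2 * B ^ 2)) := by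
  have h0 := peakPoint_quadratic A hB
  have hneg := peakPoint_neg hA hB
  rw [slopeMinus_sub_slopePlus hA, sqrt_eq_one_sub_peakPoint A hB]
  set a := peakPoint A B
  have h2 : 0 < 1 - 2 * B * a := by nlinarith
  have hq : quadMinus A B a = (1 - 2 * B * a) ^ 2 := by
    unfold quadMinus
    linear_combination (-2 * B) * h0
  have e : 2 * B * (1 - 1 / (1 - 2 * B * a)) * (1 - 2 * B * a) ^ 2 =
      2 * B * ((1 - 2 * B * a) ^ 2 - (1 - 2 * B * a)) := by
    have := h2.ne'
    generalize 1 - 2 * B * a = S at this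
    field_simp
  rw [hq, div_eq_iff (pow_pos h2 2).ne', e]
  linear_combination (-4 * B ^ 2) * h0

theorem phiMinus_le (hA : 0 < A) (hB : 0 < B) {x : ℝ} (hx : x ≤ 0) :
    phiMinus A B x ≤ (16 + (2 * A ^ 2 * B ^ 2 + 1)) / (2 * A ^ 2 * B ^ 2 + 1) *
      Real.exp (-(B / 2 * |x|)) := by
  have hc : 0 < 2 * A ^ 2 * B ^ 2 + 1 := by positivity
  have hσ : A ≤ √(x ^ 2 + A ^ 2) := Real.le_sqrt_of_sq_le (by linarith [sq_nonneg x])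
  -- Half of the exponential decay absorbs the polynomial. With y = −Bx/2 it equals 8y² + 4y + 2A²B²
  -- + 1, and 16 is chosen so that 8y² + 4y ≤ 16(1 + y + y²/2) ≤ 16 e^y.
  have hq : quadMinus A B x ≤ (16 + (2 * A ^ 2 * B ^ 2 + 1)) * Real.exp (-(B * x / 2)) := by
    have hy : 0 ≤ -(B * x / 2) := by nlinarith
    have h1 := Real.quadratic_le_exp_of_nonneg hy
    have h2 := Real.one_le_exp hy
    unfold quadMinus
    nlinarith [sq_nonneg (B * x)]
  rw [abs_of_nonpos hx, phiMinus_eq, div_mul_eq_mul_div, div_le_div_iff₀ (by positivity) hc]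
  have e : Real.exp (B * x) * Real.exp (-(B * x / 2)) = Real.exp (-(B / 2 * -x)) := by
    rw [← Real.exp_add]
    congr 1
    ring
  have h3 := mul_le_mul_of_nonneg_left hq (Real.exp_pos (B * x)).le
  rw [mul_left_comm, e] at h3
  have h4 := mul_le_mul hσ h3 (mul_pos (Real.exp_pos _) (quadMinus_pos A B x)).le
    (Real.sqrt_nonneg _)
  have h5 := mul_le_mul_of_nonneg_left h4 hc.le
  linarith

/-- The factor e^{−2Bp} pays for the stretch [p, 0], where e^{−Bx} exceeds 1. -/
theorem phiPlus_le (hA : 0 < A) (hB : 0 < B) {p x : ℝ} (hp : p ≤ 0) (hx : p ≤ x) :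
    phiPlus A B x ≤ Real.exp (-(2 * B * p)) * Real.exp (-(B / 2 * |x|)) := by
  have hσ : A ≤ √(x ^ 2 + A ^ 2) := Real.le_sqrt_of_sq_le (by linarith [sq_nonneg x])
  have h1 : phiPlus A B x ≤ Real.exp (-(B * x)) := by
    unfold phiPlus
    rw [div_le_iff₀ (by positivity), mul_comm]
    exact mul_le_mul_of_nonneg_left hσ (Real.exp_pos _).le
  refine h1.trans ?_
  rw [← Real.exp_add, Real.exp_le_exp]
  rcases le_total 0 x with h | h
  · rw [abs_of_nonneg h]
    nlinarith [mul_nonneg hB.le h, mul_nonneg hB.le (neg_nonneg.2 hp)]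
  · rw [abs_of_nonpos h]
    nlinarith [mul_nonneg hB.le (neg_nonneg.2 h), mul_nonneg hB.le (sub_nonneg.2 hx)]

theorem memLp_glued (hA : 0 < A) (hB : 0 < B) {p : ℝ} (hp : p ≤ 0) :
    MemLp (glue p (fun x => phiMinus A B x / phiMinus A B p)
      (fun x => phiPlus A B x / phiPlus A B p)) 2 volume := by
  have hm := phiMinus_pos hA B p
  have hq := phiPlus_pos hA B p
  have hc := (isPrimitive_glue_mul (isBoundedRiccati_slopeMinus hA hB)
    (isBoundedRiccati_slopePlus hA B) (hasDerivAt_phiMinus hA B) (hasDerivAt_phiPlus hA B)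
    hm.ne' hq.ne').continuous
  set C := (16 + (2 * A ^ 2 * B ^ 2 + 1)) / (2 * A ^ 2 * B ^ 2 + 1)
  have hC : 0 < C := by positivity
  refine memLp_two_of_abs_le_exp hc (half_pos hB)
    (C := C / phiMinus A B p + Real.exp (-(2 * B * p)) / phiPlus A B p) fun x => ?_
  rw [add_mul]
  rcases lt_or_ge x p with h | h
  · rw [glue_of_lt h, abs_of_pos (div_pos (phiMinus_pos hA B x) hm), div_mul_eq_mul_div]
    refine le_add_of_le_of_nonneg ?_ (by positivity)
    exact div_le_div_of_nonneg_right (phiMinus_le hA hB (h.le.trans hp)) hm.le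
  · rw [glue_of_le h, abs_of_pos (div_pos (phiPlus_pos hA B x) hq),
      div_mul_eq_mul_div (Real.exp _)]
    refine le_add_of_nonneg_of_le (by positivity) ?_
    exact div_le_div_of_nonneg_right (phiPlus_le hA hB hp h) hq.le

theorem peakData (hA : 0 < A) (hB : 0 < B) :
    PeakData (potential A B) (slopeMinus A B) (slopePlus A B) (phiMinus A B) (phiPlus A B)
      (peakPoint A B) where
  left := potential_eq hA B ▸ isBoundedRiccati_slopeMinus hA hB
  right := potential_eq hA B ▸ isBoundedRiccati_slopePlus hA B
  hasDerivAt_left := hasDerivAt_phiMinus hA B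
  hasDerivAt_right := hasDerivAt_phiPlus hA B
  left_ne x := (phiMinus_pos hA B x).ne'
  right_ne x := (phiPlus_pos hA B x).ne'
  gap_pos := by
    have := quadMinus_pos A B (peakPoint A B)
    rw [slopeMinus_sub_slopePlus hA]
    positivity
  gap_lt _ hx := gap_lt_of_ne hA hB hx
  memLp := memLp_glued hA hB (peakPoint_neg hA hB).le

end SobolevBest

theorem mainTheorem9 (A B : ℝ) (hA : 0 < A) (hB : 0 < B)
    (hAB : (1 + Real.sqrt 5) / 2 < A * B) :
    -- the potential in closed form, its upper bound and its positive lower bound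
    (∀ x : ℝ, SobolevBest.potential A B x =
      ((B * (x ^ 2 + A ^ 2) + x) ^ 2 + x ^ 2 - A ^ 2) / (x ^ 2 + A ^ 2) ^ 2) ∧
    (∃ v₁ : ℝ, ∀ x : ℝ, SobolevBest.potential A B x ≤ v₁) ∧
    0 < (A ^ 2 * B ^ 2 - A * B - 1) / A ^ 2 ∧
    (∀ x : ℝ, (A ^ 2 * B ^ 2 - A * B - 1) / A ^ 2 ≤ SobolevBest.potential A B x) ∧
    -- the best quantity
    SobolevBest.bestQuantity (SobolevBest.potential A B) =
      2 * B * (1 - 1 / Real.sqrt (1 + 4 * A ^ 2 * B ^ 2)) ∧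
    -- the unique minimizer `u` over `K_{a₁}`, in closed form, and the set of all minimizers
    ∃ u : ℝ → ℝ,
      (∀ w : ℝ → ℝ, SobolevBest.IsPeakMinimizer (SobolevBest.potential A B)
        (SobolevBest.peakPoint A B) w ↔ w = u) ∧
      (∀ x : ℝ, x < SobolevBest.peakPoint A B → u x =
        SobolevBest.phiMinus A B x / SobolevBest.phiMinus A B (SobolevBest.peakPoint A B)) ∧
      (∀ x : ℝ, SobolevBest.peakPoint A B ≤ x → u x =
        SobolevBest.phiPlus A B x / SobolevBest.phiPlus A B (SobolevBest.peakPoint A B)) ∧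
      SobolevBest.minimizers (SobolevBest.potential A B) =
        {v | ∃ c : ℝ, c ≠ 0 ∧ v = fun x => c * u x} := by
  have hD := SobolevBest.peakData hA hB
  have hV := SobolevBest.potential_eq hA B
  refine ⟨fun x => by rw [hV]; rfl, ⟨_, fun x => hV ▸ (le_abs_self _).trans
    (SobolevBest.abs_potentialFormula_le hA B x)⟩, div_pos ?_ (by positivity),
    fun x => hV ▸ SobolevBest.le_potentialFormula hA hB x,
    hD.bestQuantity_eq.trans (SobolevBest.gap_peakPoint hA hB),
    SobolevBest.gluedPeak (SobolevBest.phiMinus A B) (SobolevBest.phiPlus A B)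
      (SobolevBest.peakPoint A B),
    fun w => hD.isPeakMinimizer_iff, fun x hx => SobolevBest.glue_of_lt hx,
    fun x hx => SobolevBest.glue_of_le hx, hD.minimizers_eq⟩
  -- The golden ratio is the positive root of t² − t − 1, so this polynomial is positive at t = AB.
  have h5 : √5 ^ 2 = (5 : ℝ) := Real.sq_sqrt (by norm_num)
  have h6 : 0 ≤ √(5 : ℝ) := Real.sqrt_nonneg 5
  nlinarith
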